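/- Let $\mathbb F$ be a field. A persistence module over $\mathbb R^m$ is a functor $M$ from the poset $\mathbb R^m$ (product order) to $\mathbb F$-vector spaces. It is cubically encoded if $M\cong e^*M'$ for a monotone map $e\colon\mathbb R^m\to Q$ to a finite poset whose fibres are finite unions of products of (possibly empty or unbounded) intervals, and a functor $M'$ from $Q$ to finite-dimensional vector spaces; $\mathcal C_m$ denotes the full subcategory of cubically encoded modules. For $\alpha$ assigning a value in $[0,\infty]$ to each module, the path metric is $$d_\alpha(A,B)=\inf_\gamma\sum_i\bigl(\alpha(\ker\gamma_i)+\alpha(\operatorname{coker}\gamma_i)\bigr),$$ the infimum being over all zigzags $\gamma\colon A\xleftarrow{\gamma_1}C_1\xrightarrow{\gamma_2}\cdots\xleftarrow{}C_k\xrightarrow{}B$ in $\mathcal C_m$ (with $\inf\emptyset=\infty$). For $v\in\mathbb R^m_{\ge0}$: * the shift amplitude is $\varsigma_v(M)=\inf\{\varepsilon\ge0: M(x\le x+\varepsilon v)=0\text{ for all }x\}$; * the interleaving distance $d_{I,v}(A,B)$ is the infimum of all $\varepsilon>0$ for which there are natural maps $\varphi_x\colon A_x\to B_{x+\varepsilon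 v}$ and $\psi_x\colon B_x\to A_{x+\varepsilon v}$ whose two composites are the structure maps $A(x\le x+2\varepsilon v)$ and $B(x\le x+2\varepsilon v)$. For a measure $\mu$ on the Lebesgue $\sigma$-algebra and $1\le p<\infty$, the Hilbert amplitude is $\|M\|_{p,\mu}=\bigl(\int(\dim M_x)^p\,d\mu(x)\bigr)^{1/p}$. Let $\tau$ be a face of the positive cone of $\mathbb R^n$ of dimension $t$, $1\le t\le n-1$, that is, the cone spanned by $t$ of the standard unit vectors. Identify $\mathbb R^n/\mathbb R\tau$ with the span of the other $n-t$ unit vectors, i.e. with $\mathbb R^{n-t}$. The quotient restriction of $M$ is $(M/\tau)_w=\varinjlim_{u\in w+\tau}M_u$, with the induced structure maps. Then $(-)/\tau$ sends $\mathcal C_n$ to $\mathcal C_{n-t}$, and: 1. For every $v\in\mathbb R^n_{\ge0}$ with image $v'$ under the projection $\mathbb R^n\to\mathbb R^{n-t}$ that forgets the coordinates of $\tau$, and all $M,N\in\mathcal C_n$, $$d_{\varsigma_{v'}}(M/\tau,N/\tau)\le d_{\varsigma_v}(M,N),\qquad d_{I,v'}(M/\tau,N/\tau)\le d_{I,v}(M,N).$$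 2. For all $M,N\in\mathcal C_n$, all $K>0$ and all $1\le p<\infty$, with the Lebesgue measures $\lambda$ on $\mathbb R^n$ and $\mathbb R^{n-t}$, $$d_{\|\cdot\|_{p,\lambda}}(M/\tau,N/\tau)\le K\,d_{\|\cdot\|_{p,\lambda}}(M,N).$$ 3. For every finite measure $\mu$ on the Lebesgue $\sigma$-algebra of $\mathbb R^n$, every nonzero measure $\mu'$ on that of $\mathbb R^{n-t}$ and every $1\le p<\infty$, the map $(-)/\tau\colon\mathcal C_n\to\mathcal C_{n-t}$ is not continuous with respect to the path metrics of $\|\cdot\|_{p,\mu}$ on the source and $\|\cdot\|_{p,\mu'}$ on the target. -/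

import Mathlib

open CategoryTheory CategoryTheory.Limits MeasureTheory
open scoped ENNReal NNReal

universe u

noncomputable section

namespace PersMod

/-! Persistence modules over `ℝ^ι`, where `ι` is a finite set of coordinates and `ℝ^ι` has the
product order. -/

/-- The set `ℝ^ι` with the product order. (A type synonym, so that as a category it is the one of
this partial order.) -/
def Rn (ι : Type) : Type := ι → ℝ

instance (ι : Type) : PartialOrder (Rn ι) := inferInstanceAs (PartialOrder (ι → ℝ))

/-- Functors from the poset `ℝ^ι` to vector spaces over `𝔽`. Pointwise finite dimensionality is
part of `IsCubicallyEncoded` below. -/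
abbrev PMod (𝔽 : Type u) [Field 𝔽] (ι : Type) := Rn ι ⥤ ModuleCat.{u} 𝔽

/-- A cube in `ℝ^ι`: a product of (possibly empty, unbounded, open or closed) intervals of `ℝ`. -/
def IsCube {ι : Type} (S : Set (Rn ι)) : Prop :=
  ∃ I : ι → Set ℝ, (∀ i, (I i).OrdConnected) ∧ S = Set.univ.pi I

/-- Membership in the algebra of cubes: finite unions of cubes. -/
def IsCubical {ι : Type} (S : Set (Rn ι)) : Prop :=
  ∃ F : Set (Set (Rn ι)), F.Finite ∧ (∀ C ∈ F, IsCube C) ∧ S = ⋃₀ F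

/-- `M` is cubically encoded: `M ≅ e^* M'` for a monotone map `e` to a finite poset `Q` all of
whose fibres are finite unions of cubes, and a pointwise finite dimensional module `M'` on `Q`. -/
def IsCubicallyEncoded {𝔽 : Type u} [Field 𝔽] {ι : Type} : ObjectProperty (PMod 𝔽 ι) :=
  fun M => ∃ (Q : Type) (_ : PartialOrder Q) (_ : Finite Q) (e : Rn ι →o Q)
    (M' : Q ⥤ ModuleCat.{u} 𝔽),
    (∀ q, Module.Finite 𝔽 (M'.obj q)) ∧ (∀ q, IsCubical (e ⁻¹' {q})) ∧
      Nonempty (M ≅ e.monotone.functor ⋙ M')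

/-! ### Path metrics -/

/-- Zigzags `A ← C₁ → B₁ ← C₂ → ⋯ ← Cₖ → D` all of whose objects between the two ends
lie in the full subcategory given by `P`. -/
inductive Zigzag {𝒜 : Type*} [Category 𝒜] (P : ObjectProperty 𝒜) : 𝒜 → 𝒜 → Type _
  | nil (A : 𝒜) : Zigzag P A A
  | cons {A C B D : 𝒜} (hC : P C) (hB : P B) (f : C ⟶ A) (g : C ⟶ B) (z : Zigzag P B D) :
      Zigzag P A D

/-- The cost of a zigzag with respect to `α`: the sum of `α (ker γ) + α (coker γ)` over all its
morphisms `γ`. -/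
def Zigzag.cost {𝒜 : Type*} [Category 𝒜] [Abelian 𝒜] {P : ObjectProperty 𝒜}
    (α : 𝒜 → ℝ≥0∞) : {A B : 𝒜} → Zigzag P A B → ℝ≥0∞
  | _, _, .nil _ => 0
  | _, _, .cons _ _ f g z =>
      (α (kernel f) + α (cokernel f)) + (α (kernel g) + α (cokernel g)) + z.cost α

/-- The path metric of `α` on the full subcategory of `𝒜` given by `P`. Kernels and cokernels are
those of `𝒜`; for cubically encoded modules they lie again in the subcategory and hence are the
kernels and cokernels of the subcategory. The infimum of the empty set is `∞`. -/
def pathDist {𝒜 : Type*} [Category 𝒜] [Abelian 𝒜] (P : ObjectProperty 𝒜)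
    (α : 𝒜 → ℝ≥0∞) (A B : 𝒜) : ℝ≥0∞ :=
  ⨅ z : Zigzag P A B, z.cost α

/-- Continuity of a map on objects, from the objects in `P` with the extended pseudometric `d` to
those with the extended pseudometric `d'`. -/
def ContinuousWith {𝒜 ℬ : Type*} [Category 𝒜] (P : ObjectProperty 𝒜) (d : 𝒜 → 𝒜 → ℝ≥0∞)
    (d' : ℬ → ℬ → ℝ≥0∞) (F : 𝒜 → ℬ) : Prop :=
  ∀ M, P M → ∀ ε : ℝ≥0∞, 0 < ε → ∃ δ : ℝ≥0∞, 0 < δ ∧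
    ∀ N, P N → d M N < δ → d' (F M) (F N) < ε

/-! ### Shifts, shift amplitude, interleaving distance -/

/-- The translation `x ↦ x + ε v` of `ℝ^ι`. -/
def translate {ι : Type} (v : ι → ℝ≥0) (ε : ℝ≥0) (x : Rn ι) : Rn ι :=
  fun i => x i + (ε : ℝ) * (v i : ℝ)

theorem le_translate {ι : Type} (v : ι → ℝ≥0) (ε : ℝ≥0) (x : Rn ι) :
    x ≤ translate v ε x := fun i =>
  le_add_of_nonneg_right (mul_nonneg ε.coe_nonneg (v i).coe_nonneg)

theorem translate_mono {ι : Type} (v : ι → ℝ≥0) (ε : ℝ≥0) : Monotone (translate v ε) :=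
  fun _ _ h i => add_le_add (h i) le_rfl

/-- The shifted module `M^{+ε}`, with `(M^{+ε})_x = M_{x + ε v}`. -/
def shifted {𝔽 : Type u} [Field 𝔽] {ι : Type} (v : ι → ℝ≥0) (ε : ℝ≥0) (M : PMod 𝔽 ι) :
    PMod 𝔽 ι :=
  (translate_mono v ε).functor ⋙ M

/-- The shift amplitude along `v`: the infimum of all `ε ≥ 0` for which
`M (x ≤ x + ε v) = 0` for all `x`. -/
def shiftAmplitude {𝔽 : Type u} [Field 𝔽] {ι : Type} (v : ι → ℝ≥0) (M : PMod 𝔽 ι) : ℝ≥0∞ :=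
  ⨅ (ε : ℝ≥0) (_ : ∀ x, M.map (homOfLE (le_translate v ε x)) = 0), (ε : ℝ≥0∞)

/-- There is an `ε`-interleaving between `A` and `B` along `v`. -/
def Interleaved {𝔽 : Type u} [Field 𝔽] {ι : Type} (v : ι → ℝ≥0) (ε : ℝ≥0) (A B : PMod 𝔽 ι) :
    Prop :=
  ∃ (φ : A ⟶ shifted v ε B) (ψ : B ⟶ shifted v ε A),
    (∀ x, (φ.app x ≫ ψ.app (translate v ε x) :
        A.obj x ⟶ A.obj (translate v ε (translate v ε x))) =
      A.map (homOfLE ((le_translate v ε x).trans (le_translate v ε _)))) ∧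
    (∀ x, (ψ.app x ≫ φ.app (translate v ε x) :
        B.obj x ⟶ B.obj (translate v ε (translate v ε x))) =
      B.map (homOfLE ((le_translate v ε x).trans (le_translate v ε _))))

/-- The interleaving distance along `v`. -/
def interleavingDist {𝔽 : Type u} [Field 𝔽] {ι : Type} (v : ι → ℝ≥0) (A B : PMod 𝔽 ι) : ℝ≥0∞ :=
  ⨅ (ε : ℝ≥0) (_ : 0 < ε ∧ Interleaved v ε A B), (ε : ℝ≥0∞)

/-! ### Hilbert amplitudes -/

/-- The Lebesgue `σ`-algebra on `ℝ^ι`: the completion of the Borel `σ`-algebra with respect to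
the Lebesgue measure. -/
abbrev lebesgueAlgebra (ι : Type) [Fintype ι] : MeasurableSpace (Rn ι) :=
  inferInstanceAs (MeasurableSpace (NullMeasurableSpace (ι → ℝ) volume))

/-- The Lebesgue measure on the Lebesgue `σ`-algebra. -/
def lebesgueMeasure (ι : Type) [Fintype ι] : @Measure (Rn ι) (lebesgueAlgebra ι) :=
  Measure.completion (volume : Measure (ι → ℝ))

/-- The `p`-Hilbert amplitude `(∫ (dim M_x)^p dμ)^(1/p)`. -/
def hilbertAmplitude {𝔽 : Type u} [Field 𝔽] {ι : Type} {m : MeasurableSpace (Rn ι)}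
    (μ : Measure (Rn ι)) (p : ℝ) (M : PMod 𝔽 ι) : ℝ≥0∞ :=
  (∫⁻ x, (Module.finrank 𝔽 (M.obj x) : ℝ≥0∞) ^ p ∂μ) ^ (1 / p)

/-! ### Quotient restriction -/

/-- The face of the positive cone of `ℝ^ι` spanned by the unit vectors `e_i`, `i ∈ σ`. -/
def face {ι : Type} (σ : Finset ι) : Set (Rn ι) :=
  {u | (∀ i, 0 ≤ u i) ∧ ∀ i, i ∉ σ → u i = 0}

/-- The quotient of `ℝ^ι` by the span of the face of `σ`, identified with the span of the
orthogonal face, i.e. with the coordinates outside of `σ`. -/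
abbrev OffFace {ι : Type} (σ : Finset ι) : Type := {i : ι // i ∉ σ}

/-- The point `v + s`, where `v` is the representative in the span of the orthogonal face of a
point `w` of the quotient (that is, `w` extended by zero), and `s` lies in the face. -/
def addFace {ι : Type} [DecidableEq ι] (σ : Finset ι) (w : Rn (OffFace σ)) (s : face σ) : Rn ι :=
  fun i => (if h : i ∉ σ then w ⟨i, h⟩ else 0) + s.1 i

theorem addFace_le {ι : Type} [DecidableEq ι] (σ : Finset ι) {w w' : Rn (OffFace σ)}
    {s s' : face σ} (hw : w ≤ w') (hs : s ≤ s') : addFace σ w s ≤ addFace σ w' s' := by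
  intro i
  refine add_le_add ?_ (hs i)
  by_cases hi : i ∉ σ
  · simpa only [dif_pos hi] using hw ⟨i, hi⟩
  · simp only [dif_neg hi, le_refl]

/-- The functor that sends `w` to the subset `v + τ` of `ℝ^ι`, parametrized by `τ`, and
`w ≤ w'` to the translation of the first subset to the second. -/
def addFaceFunctor {ι : Type} [DecidableEq ι] (σ : Finset ι) :
    Rn (OffFace σ) ⥤ (face σ ⥤ Rn ι) where
  obj w := Monotone.functor (f := addFace σ w) fun _ _ hs => addFace_le σ le_rfl hs
  map {_ _} h := { app := fun _ => homOfLE (addFace_le σ (leOfHom h) le_rfl) }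

/-- The quotient restriction functor `M ↦ M/τ` along the face `τ` of `σ`:
`(M/τ)_w = colim_{u ∈ v + τ} M_u` for `v` the representative of `w`, with the induced
structure maps. -/
def quotRestrict (𝔽 : Type u) [Field 𝔽] {ι : Type} [DecidableEq ι] (σ : Finset ι) :
    PMod 𝔽 ι ⥤ PMod 𝔽 (OffFace σ) :=
  Functor.whiskeringRight (face σ) (Rn ι) (ModuleCat.{u} 𝔽) ⋙
    (Functor.whiskeringLeft _ _ _).obj (addFaceFunctor σ) ⋙
      (Functor.whiskeringRight _ _ _).obj colim

end PersMod

end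

open PersMod

/-! The points of `w + τ` are cofinal among the points that project below `w`, so M/τ is the left
Kan extension of M along the projection; its universal property carries shifts and interleavings
over with the same `ε`. The face is directed, so the colimit is exact. An exact functor maps zigzags
to zigzags and commutes with kernels and cokernels, hence an inequality of amplitudes on kernels and
cokernels passes to path metrics (`pathDist_map_le`).

A cubical encoding provides finitely many cutpoints such that M is constant on the cells of the
resulting grid. Beyond all cutpoints in the directions of `σ` the colimit has stabilised, so M/τ is
the restriction of M to an affine slice (`IsGridConstant.sliceIso`). Hence M/τ is again cubically
encoded, and the support of M contains a far-out cylinder over the support of M/τ. The cylinder has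
infinite volume unless its base is null. So the Lebesgue amplitude of M/τ is zero whenever that of M
is finite, and every `K > 0` is a Lipschitz constant.

For a finite measure, the modules supported on `{x | ∀ i ∈ σ, r ≤ x i}` tend to zero as `r` grows,
while their quotient restrictions vanish nowhere. Along a zigzag the support changes only where a
kernel or cokernel is nonzero, so `measure_supportDiff_rpow_le_pathDist` keeps these restrictions at
a fixed positive distance from zero. -/

/-! ### Quotient restriction as a left Kan extension along the projection -/

namespace PersMod

section QuotientMaps

variable {ι : Type} [DecidableEq ι] (σ : Finset ι)

/-- The projection of `ℝ^ι` that forgets the coordinates in `σ`. -/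
def proj (x : Rn ι) : Rn (OffFace σ) := fun i => x i

/-- The point of the face whose coordinates are the positive parts of those of `x`. -/
noncomputable def faceOf (x : Rn ι) : face σ :=
  ⟨fun i => if i ∈ σ then max (x i) 0 else 0, fun i => by
    by_cases hi : i ∈ σ <;> simp [hi], fun i hi => by simp [hi]⟩

variable {σ}

theorem addFace_of_mem (w : Rn (OffFace σ)) (s : face σ) {i : ι} (hi : i ∈ σ) :
    addFace σ w s i = s.1 i := by
  simp [addFace, hi]

theorem addFace_of_notMem (w : Rn (OffFace σ)) (s : face σ) {i : ι} (hi : i ∉ σ) :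
    addFace σ w s i = w ⟨i, hi⟩ := by
  simp [addFace, hi, s.2.2 i hi]

@[simp]
theorem proj_addFace (w : Rn (OffFace σ)) (s : face σ) : proj σ (addFace σ w s) = w :=
  funext fun i => addFace_of_notMem w s i.2

/-- This is the cofinality that lets `toQuot` be defined at every point projecting below `w`, not
only on `w + τ`. -/
theorem le_addFace_faceOf {x : Rn ι} {w : Rn (OffFace σ)} (h : proj σ x ≤ w) :
    x ≤ addFace σ w (faceOf σ x) := by
  intro i
  by_cases hi : i ∈ σ
  · rw [addFace_of_mem _ _ hi]
    simp [faceOf, hi]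
  · rw [addFace_of_notMem _ _ hi]
    exact h ⟨i, hi⟩

instance : IsDirectedOrder (face σ) where
  directed s t := by
    refine ⟨⟨fun i => max (s.1 i) (t.1 i), fun i => le_max_of_le_left (s.2.1 i), fun i hi => ?_⟩,
      fun i => le_max_left _ _, fun i => le_max_right _ _⟩
    simp [s.2.2 i hi, t.2.2 i hi]

instance : Nonempty (face σ) := ⟨⟨fun _ => 0, fun _ => le_rfl, fun _ _ => rfl⟩⟩

variable {𝔽 : Type u} [Field 𝔽]

/-- The map `M_{w + s} ⟶ (M/τ)_w` into the colimit. -/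
noncomputable def colimMap (M : PMod 𝔽 ι) (w : Rn (OffFace σ)) (s : face σ) :
    M.obj (addFace σ w s) ⟶ ((quotRestrict 𝔽 σ).obj M).obj w :=
  colimit.ι ((addFaceFunctor σ).obj w ⋙ M) s

/-- The map `M_x ⟶ (M/τ)_w` for `x` with projection at most `w`. -/
noncomputable def toQuot (M : PMod 𝔽 ι) (x : Rn ι) (w : Rn (OffFace σ)) (h : proj σ x ≤ w) :
    M.obj x ⟶ ((quotRestrict 𝔽 σ).obj M).obj w :=
  M.map (homOfLE (le_addFace_faceOf h)) ≫ colimMap M w (faceOf σ x)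

theorem map_colimMap (M : PMod 𝔽 ι) (w : Rn (OffFace σ)) {s t : face σ} (h : s ≤ t) :
    M.map (homOfLE (addFace_le σ le_rfl h)) ≫ colimMap M w t = colimMap M w s :=
  colimit.w ((addFaceFunctor σ).obj w ⋙ M) (homOfLE h)

/-- The choice of the face point is immaterial: by directedness, any two factor through a common
larger one. -/
theorem map_colimMap_eq_toQuot (M : PMod 𝔽 ι) {x : Rn ι} {w : Rn (OffFace σ)} {s : face σ}
    (hx : x ≤ addFace σ w s) (h : proj σ x ≤ w) :
    M.map (homOfLE hx) ≫ colimMap M w s = toQuot M x w h := by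
  obtain ⟨t, hs, ht⟩ := exists_ge_ge s (faceOf σ x)
  rw [toQuot, ← map_colimMap M w hs, ← map_colimMap M w ht, ← Category.assoc, ← Category.assoc,
    ← M.map_comp, ← M.map_comp]
  rfl

theorem toQuot_addFace (M : PMod 𝔽 ι) (w : Rn (OffFace σ)) (s : face σ) :
    toQuot M (addFace σ w s) w (proj_addFace w s).le = colimMap M w s := by
  rw [← map_colimMap_eq_toQuot M le_rfl]
  exact (congrArg (· ≫ _) (M.map_id _)).trans (Category.id_comp _)

theorem map_toQuot (M : PMod 𝔽 ι) {x y : Rn ι} (hxy : x ≤ y) {w : Rn (OffFace σ)}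
    (h : proj σ y ≤ w) :
    M.map (homOfLE hxy) ≫ toQuot M y w h =
      toQuot M x w (le_trans (fun i => hxy i) h) := by
  rw [toQuot, ← Category.assoc, ← M.map_comp]
  exact map_colimMap_eq_toQuot M (hxy.trans (le_addFace_faceOf h)) _

theorem colimMap_map (M : PMod 𝔽 ι) {w w' : Rn (OffFace σ)} (h : w ≤ w') (s : face σ) :
    colimMap M w s ≫ ((quotRestrict 𝔽 σ).obj M).map (homOfLE h) =
      M.map (homOfLE (addFace_le σ h le_rfl)) ≫ colimMap M w' s :=
  ι_colimMap (Functor.whiskerRight ((addFaceFunctor σ).map (homOfLE h)) M) s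

theorem toQuot_map (M : PMod 𝔽 ι) {x : Rn ι} {w w' : Rn (OffFace σ)} (h : proj σ x ≤ w)
    (hw : w ≤ w') :
    toQuot M x w h ≫ ((quotRestrict 𝔽 σ).obj M).map (homOfLE hw) =
      toQuot M x w' (h.trans hw) := by
  rw [toQuot, Category.assoc, colimMap_map, ← Category.assoc, ← M.map_comp]
  exact map_colimMap_eq_toQuot M _ _

theorem quot_hom_ext {M : PMod 𝔽 ι} {w : Rn (OffFace σ)} {V : ModuleCat.{u} 𝔽}
    {f g : ((quotRestrict 𝔽 σ).obj M).obj w ⟶ V}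
    (h : ∀ x hx, toQuot M x w hx ≫ f = toQuot M x w hx ≫ g) : f = g := by
  refine colimit.hom_ext (F := (addFaceFunctor σ).obj w ⋙ M) fun s => ?_
  have := h _ (proj_addFace w s).le
  rwa [toQuot_addFace] at this

/-- The universal property of the quotient restriction at a point. -/
noncomputable def quotDesc (M : PMod 𝔽 ι) (w : Rn (OffFace σ)) {V : ModuleCat.{u} 𝔽}
    (k : ∀ x, proj σ x ≤ w → (M.obj x ⟶ V))
    (hk : ∀ x y (hxy : x ≤ y) (hy : proj σ y ≤ w),
      M.map (homOfLE hxy) ≫ k y hy = k x (le_trans (fun i => hxy i) hy)) :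
    ((quotRestrict 𝔽 σ).obj M).obj w ⟶ V :=
  colimit.desc ((addFaceFunctor σ).obj w ⋙ M)
    { pt := V
      ι :=
        { app s := k _ (proj_addFace w s).le
          naturality s t h := by
            refine (hk _ _ (addFace_le σ le_rfl (leOfHom h)) _).trans (Category.comp_id _).symm } }

@[simp]
theorem toQuot_quotDesc (M : PMod 𝔽 ι) (w : Rn (OffFace σ)) {V : ModuleCat.{u} 𝔽}
    (k : ∀ x, proj σ x ≤ w → (M.obj x ⟶ V))
    (hk : ∀ x y (hxy : x ≤ y) (hy : proj σ y ≤ w),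
      M.map (homOfLE hxy) ≫ k y hy = k x (le_trans (fun i => hxy i) hy))
    (x : Rn ι) (hx : proj σ x ≤ w) :
    toQuot M x w hx ≫ quotDesc M w k hk = k x hx := by
  rw [toQuot, Category.assoc]
  refine Eq.trans (congrArg (_ ≫ ·) (colimit.ι_desc _ _)) (hk _ _ _ _)

instance quotRestrict_preservesFiniteColimits :
    PreservesFiniteColimits (quotRestrict 𝔽 σ) :=
  preservesFiniteColimits_of_evaluation _ fun w =>
    comp_preservesFiniteColimits
      ((Functor.whiskeringLeft _ _ (ModuleCat.{u} 𝔽)).obj ((addFaceFunctor σ).obj w)) colim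

instance quotRestrict_preservesFiniteLimits :
    PreservesFiniteLimits (quotRestrict 𝔽 σ) :=
  -- Exactness of filtered colimits, lowered to the universe of the index category `face σ`, which
  -- is filtered because it is directed and nonempty.
  have := AB5OfSize_shrink.{0, 0, u, u} (ModuleCat.{u} 𝔽)
  preservesFiniteLimits_of_evaluation _ fun w =>
    comp_preservesFiniteLimits
      ((Functor.whiskeringLeft _ _ (ModuleCat.{u} 𝔽)).obj ((addFaceFunctor σ).obj w)) colim

end QuotientMaps

end PersMod

/-! ### Path metrics under exact functors -/

namespace PersMod

section PathMetrics

variable {𝒜 ℬ : Type*} [Category 𝒜] [Abelian 𝒜] [Category ℬ] [Abelian ℬ]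

/-- Apply the exact functor termwise. The class `Q` only has to contain the kernels and cokernels
that occur, so these need not be shown to satisfy `P`. -/
theorem exists_zigzag_map_cost_le (F : 𝒜 ⥤ ℬ) [PreservesFiniteLimits F]
    [PreservesFiniteColimits F] {P Q : ObjectProperty 𝒜} {P' : ObjectProperty ℬ}
    (hF : ∀ X, P X → P' (F.obj X))
    (hQ : ∀ {X Y : 𝒜} (f : X ⟶ Y), P X → P Y → Q (kernel f) ∧ Q (cokernel f))
    {α : 𝒜 → ℝ≥0∞} {β : ℬ → ℝ≥0∞} (hβ : ∀ {X Y : ℬ}, (X ≅ Y) → β X = β Y) (K : ℝ≥0∞)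
    (hαβ : ∀ X, Q X → β (F.obj X) ≤ K * α X) {A B : 𝒜} (z : Zigzag P A B) (hA : P A) :
    ∃ z' : Zigzag P' (F.obj A) (F.obj B), z'.cost β ≤ K * z.cost α := by
  have : F.PreservesZeroMorphisms := inferInstance
  have key {X Y : 𝒜} (f : X ⟶ Y) (hX : P X) (hY : P Y) :
      β (kernel (F.map f)) + β (cokernel (F.map f)) ≤ K * (α (kernel f) + α (cokernel f)) := by
    rw [← hβ (PreservesKernel.iso F f), ← hβ (PreservesCokernel.iso F f), mul_add]
    exact add_le_add (hαβ _ (hQ f hX hY).1) (hαβ _ (hQ f hX hY).2)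
  induction z with
  | nil A => exact ⟨.nil _, zero_le⟩
  | cons hC hB f g z ih =>
    obtain ⟨z', hz'⟩ := ih hB
    refine ⟨.cons (hF _ hC) (hF _ hB) (F.map f) (F.map g) z', ?_⟩
    simp only [Zigzag.cost]
    rw [mul_add, mul_add]
    exact add_le_add (add_le_add (key f hC hA) (key g hC hB)) hz'

theorem pathDist_map_le (F : 𝒜 ⥤ ℬ) [PreservesFiniteLimits F]
    [PreservesFiniteColimits F] {P Q : ObjectProperty 𝒜} {P' : ObjectProperty ℬ}
    (hF : ∀ X, P X → P' (F.obj X))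
    (hQ : ∀ {X Y : 𝒜} (f : X ⟶ Y), P X → P Y → Q (kernel f) ∧ Q (cokernel f))
    {α : 𝒜 → ℝ≥0∞} {β : ℬ → ℝ≥0∞} (hβ : ∀ {X Y : ℬ}, (X ≅ Y) → β X = β Y) {K : ℝ≥0∞}
    (hK : K ≠ 0) (hK' : K ≠ ⊤)
    (hαβ : ∀ X, Q X → β (F.obj X) ≤ K * α X) {A B : 𝒜} (hA : P A) :
    pathDist P' β (F.obj A) (F.obj B) ≤ K * pathDist P α A B := by
  rw [pathDist, pathDist, ENNReal.mul_iInf_of_ne hK hK']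
  refine le_iInf fun z => ?_
  obtain ⟨z', hz'⟩ := exists_zigzag_map_cost_le F hF hQ hβ K hαβ z hA
  exact (iInf_le _ z').trans hz'

end PathMetrics

/-! ### Shift amplitudes and interleaving distances -/

section Shifts

variable {𝔽 : Type u} [Field 𝔽] {ι : Type}

theorem shiftAmplitude_le_of_iso (v : ι → ℝ≥0) {M N : PMod 𝔽 ι} (e : M ≅ N) :
    shiftAmplitude v N ≤ shiftAmplitude v M := by
  refine le_iInf₂ fun ε hε => iInf₂_le ε fun x => ?_
  have h : e.inv.app x ≫ M.map (homOfLE (le_translate v ε x)) ≫ e.hom.app _ =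
      N.map (homOfLE (le_translate v ε x)) := by
    rw [e.hom.naturality, ← Category.assoc, ← NatTrans.comp_app, e.inv_hom_id, NatTrans.id_app,
      Category.id_comp]
  rw [← h, hε, zero_comp, comp_zero]

theorem shiftAmplitude_iso (v : ι → ℝ≥0) {M N : PMod 𝔽 ι} (e : M ≅ N) :
    shiftAmplitude v M = shiftAmplitude v N :=
  (shiftAmplitude_le_of_iso v e.symm).antisymm (shiftAmplitude_le_of_iso v e)

/-- The components of a map into a shifted module. -/
def shiftApp {v : ι → ℝ≥0} {ε : ℝ≥0} {A B : PMod 𝔽 ι} (φ : A ⟶ shifted v ε B) (x : Rn ι) :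
    A.obj x ⟶ B.obj (translate v ε x) :=
  φ.app x

theorem map_shiftApp {v : ι → ℝ≥0} {ε : ℝ≥0} {A B : PMod 𝔽 ι} (φ : A ⟶ shifted v ε B)
    {x y : Rn ι} (h : x ≤ y) :
    A.map (homOfLE h) ≫ shiftApp φ y =
      shiftApp φ x ≫ B.map (homOfLE (translate_mono v ε h)) :=
  φ.naturality _

variable {σ : Finset ι}

/-- Projecting commutes with translating, definitionally, so monotonicity of the translation
suffices. -/
theorem proj_translate_le {v : ι → ℝ≥0} {ε : ℝ≥0} {x : Rn ι} {w : Rn (OffFace σ)}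
    (h : proj σ x ≤ w) :
    proj σ (translate v ε x) ≤ translate (fun i : OffFace σ => v i) ε w :=
  translate_mono (fun i : OffFace σ => v i) ε h

variable [DecidableEq ι]

/-- On the image of `M.obj x`, the shift in the colimit factors through the shift of M at `x`, and
these images determine a map out of the colimit. -/
theorem shiftAmplitude_quotRestrict_le (v : ι → ℝ≥0) (M : PMod 𝔽 ι) :
    shiftAmplitude (fun i : OffFace σ => v i) ((quotRestrict 𝔽 σ).obj M) ≤
      shiftAmplitude v M := by
  refine le_iInf₂ fun ε hε => iInf₂_le ε fun w => quot_hom_ext fun x hx => ?_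
  rw [toQuot_map, comp_zero, ← map_toQuot M (le_translate v ε x) (proj_translate_le hx), hε,
    zero_comp]

/-- The map of quotient restrictions induced by a map into a shifted module, at a point. -/
noncomputable def quotShiftApp {v : ι → ℝ≥0} {ε : ℝ≥0} {A B : PMod 𝔽 ι}
    (φ : A ⟶ shifted v ε B) (w : Rn (OffFace σ)) :
    ((quotRestrict 𝔽 σ).obj A).obj w ⟶
      ((quotRestrict 𝔽 σ).obj B).obj (translate (fun i : OffFace σ => v i) ε w) :=
  quotDesc A w (fun x hx => shiftApp φ x ≫ toQuot B (translate v ε x) _ (proj_translate_le hx))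
    fun x y hxy hy => by
      rw [← Category.assoc, map_shiftApp, Category.assoc, map_toQuot]

theorem toQuot_quotShiftApp {v : ι → ℝ≥0} {ε : ℝ≥0} {A B : PMod 𝔽 ι} (φ : A ⟶ shifted v ε B)
    {x : Rn ι} {w : Rn (OffFace σ)} (hx : proj σ x ≤ w) :
    toQuot A x w hx ≫ quotShiftApp φ w =
      shiftApp φ x ≫ toQuot B (translate v ε x) _ (proj_translate_le hx) :=
  toQuot_quotDesc _ _ _ _ _ _

theorem map_quotShiftApp {v : ι → ℝ≥0} {ε : ℝ≥0} {A B : PMod 𝔽 ι} (φ : A ⟶ shifted v ε B)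
    {w w' : Rn (OffFace σ)} (h : w ≤ w') :
    ((quotRestrict 𝔽 σ).obj A).map (homOfLE h) ≫ quotShiftApp φ w' =
      quotShiftApp φ w ≫ ((quotRestrict 𝔽 σ).obj B).map (homOfLE (translate_mono _ ε h)) := by
  refine quot_hom_ext fun x hx => ?_
  rw [← Category.assoc, ← Category.assoc, toQuot_map, toQuot_quotShiftApp, toQuot_quotShiftApp,
    Category.assoc, toQuot_map]

/-- The map of quotient restrictions induced by a map into a shifted module. -/
noncomputable def quotShift {v : ι → ℝ≥0} {ε : ℝ≥0} {A B : PMod 𝔽 ι} (φ : A ⟶ shifted v ε B) :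
    (quotRestrict 𝔽 σ).obj A ⟶
      shifted (fun i : OffFace σ => v i) ε ((quotRestrict 𝔽 σ).obj B) where
  app w := quotShiftApp φ w
  naturality _ _ h := map_quotShiftApp φ (leOfHom h)

theorem quotShiftApp_comp_quotShiftApp {v : ι → ℝ≥0} {ε : ℝ≥0} {A B : PMod 𝔽 ι}
    (φ : A ⟶ shifted v ε B) (ψ : B ⟶ shifted v ε A)
    (h : ∀ x, shiftApp φ x ≫ shiftApp ψ (translate v ε x) =
      A.map (homOfLE ((le_translate v ε x).trans (le_translate v ε _)))) (w : Rn (OffFace σ)) :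
    quotShiftApp φ w ≫ quotShiftApp ψ (translate (fun i : OffFace σ => v i) ε w) =
      ((quotRestrict 𝔽 σ).obj A).map
        (homOfLE ((le_translate _ ε w).trans (le_translate _ ε _))) := by
  refine quot_hom_ext fun x hx => ?_
  rw [toQuot_map, ← Category.assoc, toQuot_quotShiftApp, Category.assoc, toQuot_quotShiftApp,
    ← Category.assoc, h, map_toQuot]

theorem interleavingDist_quotRestrict_le (v : ι → ℝ≥0) (A B : PMod 𝔽 ι) :
    interleavingDist (fun i : OffFace σ => v i)
        ((quotRestrict 𝔽 σ).obj A) ((quotRestrict 𝔽 σ).obj B) ≤ interleavingDist v A B := by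
  refine le_iInf₂ fun ε ⟨hε, φ, ψ, hφ, hψ⟩ => iInf₂_le ε ⟨hε, quotShift φ, quotShift ψ, ?_, ?_⟩
  · exact quotShiftApp_comp_quotShiftApp φ ψ hφ
  · exact quotShiftApp_comp_quotShiftApp ψ φ hψ

end Shifts

end PersMod

/-! ### Modules that are constant on the cells of a grid -/

namespace PersMod

section Grid

variable {ι : Type}

/-- Two points lie in the same cell of the grid with the cutpoints `T` on every coordinate axis. -/
def SameCell (T : Finset ℝ) (x y : Rn ι) : Prop :=
  ∀ i, ∀ c ∈ T, (c < x i ↔ c < y i) ∧ (c ≤ x i ↔ c ≤ y i)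

theorem SameCell.symm {T : Finset ℝ} {x y : Rn ι} (h : SameCell T x y) : SameCell T y x :=
  fun i c hc => ⟨(h i c hc).1.symm, (h i c hc).2.symm⟩

theorem SameCell.mono {T T' : Finset ℝ} (hT : T ⊆ T') {x y : Rn ι} (h : SameCell T' x y) :
    SameCell T x y :=
  fun i c hc => h i c (hT hc)

/-- The coordinatewise maximum. -/
def maxPt (x y : Rn ι) : Rn ι := fun i => max (x i) (y i)

theorem le_maxPt_left (x y : Rn ι) : x ≤ maxPt x y := fun _ => le_max_left _ _

theorem le_maxPt_right (x y : Rn ι) : y ≤ maxPt x y := fun _ => le_max_right _ _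

theorem SameCell.maxPt {T : Finset ℝ} {x y : Rn ι} (h : SameCell T x y) :
    SameCell T x (maxPt x y) := by
  intro i c hc
  have := h i c hc
  simp only [PersMod.maxPt, lt_max_iff, le_max_iff]
  tauto

/-- The endpoints serve as cutpoints; strict and weak comparisons together detect whether an
endpoint belongs to `I`. If `I` is unbounded on a side, the default value there is a harmless extra
cutpoint: a point outside `I` on one side of a point of `I` bounds `I` on that side, so the endpoint
used is genuine. -/
theorem exists_cutpoints_ordConnected {I : Set ℝ} (hI : I.OrdConnected) :
    ∃ T : Finset ℝ, ∀ a b : ℝ, (∀ c ∈ T, (c < a ↔ c < b) ∧ (c ≤ a ↔ c ≤ b)) →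
      (a ∈ I ↔ b ∈ I) := by
  classical
  suffices ∀ a b : ℝ, (∀ c ∈ ({sInf I, sSup I} : Finset ℝ), (c < a ↔ c < b) ∧ (c ≤ a ↔ c ≤ b)) →
      a ∈ I → b ∈ I from
    ⟨{sInf I, sSup I}, fun a b h =>
      ⟨this a b h, this b a fun c hc => ⟨(h c hc).1.symm, (h c hc).2.symm⟩⟩⟩
  intro a b h ha
  by_contra hb
  have h1 := h (sInf I) (by simp)
  have h2 := h (sSup I) (by simp)
  rcases lt_trichotomy a b with hab | rfl | hab
  · have hbd : ∀ y ∈ I, y ≤ b := fun y hy => by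
      by_contra! hlt
      exact hb (hI.out ha hy ⟨hab.le, hlt.le⟩)
    have h3 : a ≤ sSup I := le_csSup ⟨b, hbd⟩ ha
    have h4 : sSup I ≤ b := csSup_le ⟨a, ha⟩ hbd
    have h5 := h2.2.2 h4
    have h6 : sSup I = a := le_antisymm h5 h3
    exact absurd (h2.1.2 (h6 ▸ hab)) (by simp [h6])
  · exact hb ha
  · have hbd : ∀ y ∈ I, b ≤ y := fun y hy => by
      by_contra! hlt
      exact hb (hI.out hy ha ⟨hlt.le, hab.le⟩)
    have h3 : sInf I ≤ a := csInf_le ⟨b, hbd⟩ ha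
    have h4 : b ≤ sInf I := le_csInf ⟨a, ha⟩ hbd
    have h5 := h1.2.1 h3
    have h6 : sInf I = b := le_antisymm h5 h4
    exact absurd (h1.1.1 (h6 ▸ hab)) (by simp [h6])

theorem exists_cutpoints_of_finite {α β : Type*} {s : Set α} (hs : s.Finite)
    {R : Finset β → α → Prop} (hR : ∀ T T' a, T ⊆ T' → R T a → R T' a)
    (h : ∀ a ∈ s, ∃ T, R T a) : ∃ T, ∀ a ∈ s, R T a := by
  classical
  choose! f hf using h
  refine ⟨hs.toFinset.biUnion f, fun a ha => hR _ _ a ?_ (hf a ha)⟩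
  exact Finset.subset_biUnion_of_mem f (hs.mem_toFinset.2 ha)

variable [Finite ι]

theorem IsCube.exists_cutpoints {S : Set (Rn ι)} (hS : IsCube S) :
    ∃ T : Finset ℝ, ∀ x y : Rn ι, SameCell T x y → (x ∈ S ↔ y ∈ S) := by
  obtain ⟨I, hI, rfl⟩ := hS
  obtain ⟨T, hT⟩ := exists_cutpoints_of_finite (Set.finite_univ (α := ι))
    (R := fun (T : Finset ℝ) i => ∀ a b : ℝ, (∀ c ∈ T, (c < a ↔ c < b) ∧ (c ≤ a ↔ c ≤ b)) →
      (a ∈ I i ↔ b ∈ I i))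
    (fun T T' i hTT' h a b hab => h a b fun c hc => hab c (hTT' hc))
    (fun i _ => exists_cutpoints_ordConnected (hI i))
  exact ⟨T, fun x y h => forall₂_congr fun i hi => hT i hi _ _ (h i)⟩

theorem IsCubical.exists_cutpoints {S : Set (Rn ι)} (hS : IsCubical S) :
    ∃ T : Finset ℝ, ∀ x y : Rn ι, SameCell T x y → (x ∈ S ↔ y ∈ S) := by
  obtain ⟨F, hF, hc, rfl⟩ := hS
  obtain ⟨T, hT⟩ := exists_cutpoints_of_finite hF
    (R := fun (T : Finset ℝ) C => ∀ x y : Rn ι, SameCell T x y → (x ∈ C ↔ y ∈ C))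
    (fun T T' C hTT' h x y hxy => h x y (hxy.mono hTT')) (fun C hC => (hc C hC).exists_cutpoints)
  refine ⟨T, fun x y h => ?_⟩
  simp only [Set.mem_sUnion]
  exact exists_congr fun C => and_congr_right fun hC => hT C hC x y h

theorem exists_cutpoints_map {Q : Type*} [Finite Q] {e : Rn ι → Q}
    (he : ∀ q, IsCubical (e ⁻¹' {q})) :
    ∃ T : Finset ℝ, ∀ x y : Rn ι, SameCell T x y → e x = e y := by
  obtain ⟨T, hT⟩ := exists_cutpoints_of_finite (Set.finite_univ (α := Q))
    (R := fun (T : Finset ℝ) q => ∀ x y : Rn ι, SameCell T x y →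
      (x ∈ e ⁻¹' {q} ↔ y ∈ e ⁻¹' {q}))
    (fun T T' C hTT' h x y hxy => h x y (hxy.mono hTT')) (fun q _ => (he q).exists_cutpoints)
  exact ⟨T, fun x y h => ((hT (e x) trivial x y h).1 rfl).symm⟩

theorem measurableSet_of_sameCell {T : Finset ℝ} {S : Set (ι → ℝ)}
    (hS : ∀ x y : Rn ι, SameCell T x y → x ∈ S → y ∈ S) : MeasurableSet S := by
  classical
  -- Cells are the fibres of this measurable map to a finite type.
  let κ : (ι → ℝ) → ι → T → Prop × Prop := fun x i c => (c.1 < x i, c.1 ≤ x i)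
  have hκ : Measurable κ := by
    have := Fintype.ofFinite ι
    refine measurable_pi_iff.2 fun i => measurable_pi_iff.2 fun c => ?_
    refine Measurable.prodMk ?_ ?_
    · exact measurableSet_setOfPred.1 (measurableSet_lt measurable_const (measurable_pi_apply i))
    · exact measurableSet_setOfPred.1 (measurableSet_le measurable_const (measurable_pi_apply i))
  have : S = κ ⁻¹' (κ '' S) := by
    refine Set.Subset.antisymm (Set.subset_preimage_image κ S) ?_
    rintro y ⟨x, hx, hxy⟩
    refine hS x y (fun i c hc => ?_) hx
    have := congrFun (congrFun hxy i) ⟨c, hc⟩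
    simpa only [κ, Prod.mk.injEq, eq_iff_iff] using this
  rw [this]
  exact hκ (Set.toFinite _).measurableSet

end Grid

/-! ### Kernels, cokernels and supports of grid-constant modules. -/

section GridModules

variable {𝔽 : Type u} [Field 𝔽] {ι : Type}

/-- The structure maps between points of the same cell are isomorphisms. -/
def IsGridConstant (T : Finset ℝ) (M : PMod 𝔽 ι) : Prop :=
  ∀ x y (h : x ≤ y), SameCell T x y → IsIso (M.map (homOfLE h))

theorem IsGridConstant.mono {T T' : Finset ℝ} (hT : T ⊆ T') {M : PMod 𝔽 ι}
    (h : IsGridConstant T M) : IsGridConstant T' M :=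
  fun x y hxy hc => h x y hxy (hc.mono hT)

theorem IsGridConstant.of_iso {T : Finset ℝ} {M N : PMod 𝔽 ι} (e : M ≅ N)
    (h : IsGridConstant T M) : IsGridConstant T N := fun x y hxy hc => by
  have := h x y hxy hc
  exact (NatIso.isIso_map_iff e (homOfLE hxy)).1 this

theorem IsCubicallyEncoded.exists_isGridConstant [Finite ι] {M : PMod 𝔽 ι}
    (hM : IsCubicallyEncoded M) : ∃ T, IsGridConstant T M := by
  obtain ⟨Q, _, _, e, M', -, he, ⟨i⟩⟩ := hM
  obtain ⟨T, hT⟩ := exists_cutpoints_map he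
  refine ⟨T, IsGridConstant.of_iso i.symm fun x y h hc => ?_⟩
  have : IsIso (e.monotone.functor.map (homOfLE h)) :=
    ⟨homOfLE (hT x y hc).ge, Subsingleton.elim _ _, Subsingleton.elim _ _⟩
  exact Functor.map_isIso M' _

/-- The value of a kernel at a point. -/
noncomputable def kernelObjIso {M N : PMod 𝔽 ι} (f : M ⟶ N) (x : Rn ι) :
    (kernel f).obj x ≅ kernel (f.app x) :=
  PreservesKernel.iso ((evaluation _ _).obj x) f

/-- The value of a cokernel at a point. -/
noncomputable def cokernelObjIso {M N : PMod 𝔽 ι} (f : M ⟶ N) (x : Rn ι) :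
    (cokernel f).obj x ≅ cokernel (f.app x) :=
  PreservesCokernel.iso ((evaluation _ _).obj x) f

theorem kernelObjIso_hom_ι {M N : PMod 𝔽 ι} (f : M ⟶ N) (x : Rn ι) :
    (kernelObjIso f x).hom ≫ kernel.ι (f.app x) = (kernel.ι f).app x :=
  kernelComparison_comp_ι f ((evaluation _ (ModuleCat.{u} 𝔽)).obj x)

theorem π_cokernelObjIso_inv {M N : PMod 𝔽 ι} (f : M ⟶ N) (x : Rn ι) :
    cokernel.π (f.app x) ≫ (cokernelObjIso f x).inv = (cokernel.π f).app x :=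
  π_comp_cokernelComparison f ((evaluation _ (ModuleCat.{u} 𝔽)).obj x)

/-- Within a cell the naturality square of `f` has invertible structure maps, so it induces an
isomorphism of pointwise kernels. -/
theorem IsGridConstant.kernel {T : Finset ℝ} {M N : PMod 𝔽 ι} (hM : IsGridConstant T M)
    (hN : IsGridConstant T N) (f : M ⟶ N) : IsGridConstant T (kernel f) := fun x y h hc => by
  have := hM x y h hc
  have := hN x y h hc
  have key : (Limits.kernel f).map (homOfLE h) = (kernelObjIso f x).hom ≫
      (kernel.mapIso (f.app x) (f.app y) (asIso (M.map (homOfLE h))) (asIso (N.map (homOfLE h)))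
        (f.naturality _).symm).hom ≫ (kernelObjIso f y).inv := by
    rw [← Category.assoc, Iso.eq_comp_inv, ← cancel_mono (kernel.ι (f.app y)), Category.assoc,
      kernelObjIso_hom_ι, (kernel.ι f).naturality, ← kernelObjIso_hom_ι]
    simp [kernel.mapIso]
  rw [key]
  infer_instance

theorem IsGridConstant.cokernel {T : Finset ℝ} {M N : PMod 𝔽 ι} (hM : IsGridConstant T M)
    (hN : IsGridConstant T N) (f : M ⟶ N) : IsGridConstant T (cokernel f) := fun x y h hc => by
  have := hM x y h hc
  have := hN x y h hc
  have key : (Limits.cokernel f).map (homOfLE h) = (cokernelObjIso f x).hom ≫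
      (cokernel.mapIso (f.app x) (f.app y) (asIso (M.map (homOfLE h)))
        (asIso (N.map (homOfLE h))) (f.naturality _).symm).hom ≫ (cokernelObjIso f y).inv := by
    rw [← Iso.inv_comp_eq, ← cancel_epi (cokernel.π (f.app x)), ← Category.assoc,
      π_cokernelObjIso_inv, ← (cokernel.π f).naturality, ← π_cokernelObjIso_inv]
    simp [cokernel.mapIso]
  rw [key]
  infer_instance

theorem IsCubicallyEncoded.exists_isGridConstant_kernel_cokernel [Finite ι] {M N : PMod 𝔽 ι}
    (f : M ⟶ N) (hM : IsCubicallyEncoded M) (hN : IsCubicallyEncoded N) :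
    (∃ T, IsGridConstant T (Limits.kernel f)) ∧ ∃ T, IsGridConstant T (Limits.cokernel f) := by
  classical
  obtain ⟨T, hT⟩ := hM.exists_isGridConstant
  obtain ⟨T', hT'⟩ := hN.exists_isGridConstant
  have h1 := hT.mono (Finset.subset_union_left (s₂ := T'))
  have h2 := hT'.mono (Finset.subset_union_right (s₁ := T))
  exact ⟨⟨_, h1.kernel h2 f⟩, ⟨_, h1.cokernel h2 f⟩⟩

/-- The points at which a module does not vanish. -/
def moduleSupport (M : PMod 𝔽 ι) : Set (ι → ℝ) := {x : Rn ι | ¬ IsZero (M.obj x)}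

/-- Two points of a cell may be incomparable; their coordinatewise maximum lies in the same cell and
above both. -/
theorem IsGridConstant.isZero_iff {T : Finset ℝ} {M : PMod 𝔽 ι} (hM : IsGridConstant T M)
    {x y : Rn ι} (h : SameCell T x y) : IsZero (M.obj x) ↔ IsZero (M.obj y) := by
  have h1 := hM x _ (le_maxPt_left x y) h.maxPt
  have h2 := hM y _ (le_maxPt_right x y) fun i c hc =>
    ⟨(h.symm i c hc).1.trans (h.maxPt i c hc).1, (h.symm i c hc).2.trans (h.maxPt i c hc).2⟩
  exact (asIso (M.map (homOfLE (le_maxPt_left x y)))).isZero_iff.trans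
    (asIso (M.map (homOfLE (le_maxPt_right x y)))).isZero_iff.symm

theorem IsGridConstant.measurableSet_moduleSupport [Finite ι] {T : Finset ℝ} {M : PMod 𝔽 ι}
    (hM : IsGridConstant T M) : MeasurableSet (moduleSupport M) :=
  measurableSet_of_sameCell (T := T) fun _ _ h hx hy => hx ((hM.isZero_iff h).2 hy)

end GridModules

/-! ### Quotient restriction of cubically encoded modules -/

section QuotientSlices

variable {𝔽 : Type u} [Field 𝔽] {ι : Type} [DecidableEq ι] {σ : Finset ι}

/-- The inclusion of `ℝ^ι / ℝτ` as the affine subspace through a point of the face. -/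
def slice (s : face σ) : Rn (OffFace σ) →o Rn ι where
  toFun w := addFace σ w s
  monotone' _ _ h := addFace_le σ h le_rfl

/-- The point of the face whose coordinates are all equal to `r`. -/
def facePt (σ : Finset ι) (r : ℝ≥0) : face σ :=
  ⟨fun i => if i ∈ σ then r else 0, fun i => by by_cases hi : i ∈ σ <;> simp [hi],
    fun i hi => by simp [hi]⟩

/-- The face coordinates of `s` lie beyond all cutpoints. -/
def IsBeyond (T : Finset ℝ) (s : face σ) : Prop := ∀ i ∈ σ, ∀ c ∈ T, c < s.1 i

omit [DecidableEq ι] in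
theorem IsBeyond.mono {T : Finset ℝ} {s t : face σ} (hs : IsBeyond T s) (h : s ≤ t) :
    IsBeyond T t :=
  fun i hi c hc => (hs i hi c hc).trans_le (h i)

theorem exists_isBeyond_facePt (σ : Finset ι) (T : Finset ℝ) :
    ∃ r : ℝ≥0, IsBeyond T (facePt σ r) := by
  -- The sum of absolute values bounds every cutpoint, and the extra one makes the inequality
  -- strict.
  refine ⟨∑ c ∈ T, ‖c‖₊ + 1, fun i hi c hc => ?_⟩
  have h1 : ‖c‖ ≤ ∑ c ∈ T, ‖c‖ :=
    Finset.single_le_sum (f := fun c : ℝ => ‖c‖) (fun _ _ => norm_nonneg _) hc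
  have h2 := le_abs_self c
  rw [Real.norm_eq_abs] at h1
  simp only [facePt, hi, if_true, NNReal.coe_add, NNReal.coe_sum, coe_nnnorm, NNReal.coe_one]
  linarith

theorem IsBeyond.sameCell {T : Finset ℝ} {s t : face σ} (hs : IsBeyond T s) (ht : IsBeyond T t)
    (w : Rn (OffFace σ)) : SameCell T (addFace σ w s) (addFace σ w t) := by
  intro i c hc
  by_cases hi : i ∈ σ
  · rw [addFace_of_mem _ _ hi, addFace_of_mem _ _ hi]
    have h1 := hs i hi c hc
    have h2 := ht i hi c hc
    simp [h1, h2, h1.le, h2.le]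
  · rw [addFace_of_notMem _ _ hi, addFace_of_notMem _ _ hi]
    simp

/-- Beyond the cutpoints, moving along the face never leaves the cell, so the diagram is constant
from `s` on. -/
theorem IsGridConstant.isIso_colimMap {T : Finset ℝ} {M : PMod 𝔽 ι} (hM : IsGridConstant T M)
    {s : face σ} (hs : IsBeyond T s) (w : Rn (OffFace σ)) : IsIso (colimMap M w s) := by
  have h : ((addFaceFunctor σ).obj w ⋙ M).IsEventuallyConstantFrom s := fun t f =>
    hM _ _ (addFace_le σ le_rfl (leOfHom f)) (hs.sameCell (hs.mono (leOfHom f)) w)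
  exact h.isIso_ι_of_isColimit (colimit.isColimit _)

/-- The quotient restriction of a module that is constant on the cells of a grid is its
restriction to an affine subspace beyond the grid. -/
noncomputable def IsGridConstant.sliceIso {T : Finset ℝ} {M : PMod 𝔽 ι}
    (hM : IsGridConstant T M) {s : face σ} (hs : IsBeyond T s) :
    (slice s).monotone.functor ⋙ M ≅ (quotRestrict 𝔽 σ).obj M :=
  NatIso.ofComponents
    (fun w => @asIso _ _ _ _ (colimMap M w s) (hM.isIso_colimMap hs w))
    fun h => (colimMap_map M (leOfHom h) s).symm

theorem IsCube.preimage_slice [Nonempty (OffFace σ)] {C : Set (Rn ι)} (hC : IsCube C)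
    (s : face σ) : IsCube (slice s ⁻¹' C) := by
  obtain ⟨I, hI, rfl⟩ := hC
  -- The conditions on the coordinates in `σ` do not depend on `w`; they are repeated in every
  -- factor. With no factor at all they would be lost, hence `Nonempty (OffFace σ)`.
  refine ⟨fun i => {a | a ∈ I i ∧ ∀ j ∈ σ, s.1 j ∈ I j}, fun i =>
    ⟨fun a ha b hb c hc => ⟨(hI i).out ha.1 hb.1 hc, ha.2⟩⟩, ?_⟩
  refine Set.Subset.antisymm (fun w h i _ => ⟨?_, fun j hj => ?_⟩) (fun w h i _ => ?_)
  · exact (addFace_of_notMem w s i.2) ▸ h i trivial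
  · exact (addFace_of_mem w s hj) ▸ h j trivial
  · change addFace σ w s i ∈ I i
    by_cases hi : i ∈ σ
    · rw [addFace_of_mem w s hi]
      exact (h (Classical.arbitrary _) trivial).2 i hi
    · rw [addFace_of_notMem w s hi]
      exact (h ⟨i, hi⟩ trivial).1

theorem IsCubical.preimage_slice [Nonempty (OffFace σ)] {S : Set (Rn ι)} (hS : IsCubical S)
    (s : face σ) : IsCubical (slice s ⁻¹' S) := by
  obtain ⟨F, hF, hC, rfl⟩ := hS
  refine ⟨(slice s ⁻¹' ·) '' F, hF.image _, ?_, ?_⟩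
  · rintro _ ⟨C, hCF, rfl⟩
    exact (hC C hCF).preimage_slice s
  · rw [Set.sUnion_image, Set.sUnion_eq_biUnion, Set.preimage_iUnion₂]

theorem IsCubicallyEncoded.quotRestrict [Finite ι] [Nonempty (OffFace σ)] {M : PMod 𝔽 ι}
    (hM : IsCubicallyEncoded M) : IsCubicallyEncoded ((quotRestrict 𝔽 σ).obj M) := by
  obtain ⟨T, hT⟩ := hM.exists_isGridConstant
  obtain ⟨r, hr⟩ := exists_isBeyond_facePt σ T
  obtain ⟨Q, _, _, e, M', hM', he, ⟨i⟩⟩ := hM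
  refine ⟨Q, inferInstance, inferInstance, e.comp (slice (facePt σ r)), M', hM',
    fun q => (he q).preimage_slice _, ⟨(hT.sliceIso hr).symm ≪≫ ?_⟩⟩
  exact Functor.isoWhiskerLeft _ i

end QuotientSlices

end PersMod

/-! ### Hilbert amplitudes -/

namespace PersMod

section Tame

variable {𝔽 : Type u} [Field 𝔽] {ι : Type}

/-- Pointwise finite dimensional modules that are constant on the cells of a grid. -/
def IsTame : ObjectProperty (PMod 𝔽 ι) := fun M =>
  (∃ T, IsGridConstant T M) ∧ ∀ x, Module.Finite 𝔽 (M.obj x)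

theorem IsCubicallyEncoded.finite_obj {M : PMod 𝔽 ι} (hM : IsCubicallyEncoded M) (x : Rn ι) :
    Module.Finite 𝔽 (M.obj x) := by
  obtain ⟨Q, _, _, e, M', hM', -, ⟨i⟩⟩ := hM
  have : Module.Finite 𝔽 ((e.monotone.functor ⋙ M').obj x) := hM' _
  exact Module.Finite.equiv (i.app x).symm.toLinearEquiv

/-- Tameness is all that the amplitude estimates require of kernels and cokernels, so no encoding of
them is constructed. -/
theorem IsCubicallyEncoded.isTame_kernel_cokernel [Finite ι] {M N : PMod 𝔽 ι} (f : M ⟶ N)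
    (hM : IsCubicallyEncoded M) (hN : IsCubicallyEncoded N) :
    IsTame (kernel f) ∧ IsTame (cokernel f) := by
  obtain ⟨h1, h2⟩ := exists_isGridConstant_kernel_cokernel f hM hN
  refine ⟨⟨h1, fun x => ?_⟩, ⟨h2, fun x => ?_⟩⟩
  · have := hM.finite_obj x
    have := Module.Finite.of_injective (kernel.ι (f.app x)).hom
      ((ModuleCat.mono_iff_injective _).1 inferInstance)
    exact Module.Finite.equiv (kernelObjIso f x).symm.toLinearEquiv
  · have := hN.finite_obj x
    have := Module.Finite.of_surjective (cokernel.π (f.app x)).hom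
      ((ModuleCat.epi_iff_surjective _).1 inferInstance)
    exact Module.Finite.equiv (cokernelObjIso f x).symm.toLinearEquiv

theorem finrank_eq_zero_of_isZero {V : ModuleCat.{u} 𝔽} (hV : IsZero V) :
    Module.finrank 𝔽 V = 0 := by
  have := ModuleCat.subsingleton_of_isZero hV
  exact Module.finrank_zero_of_subsingleton

theorem one_le_finrank_of_not_isZero {V : ModuleCat.{u} 𝔽} [Module.Finite 𝔽 V]
    (hV : ¬ IsZero V) : 1 ≤ Module.finrank 𝔽 V := by
  by_contra! h
  have := Module.finrank_zero_iff.1 (Nat.lt_one_iff.1 h)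
  exact hV (ModuleCat.isZero_of_subsingleton V)

end Tame

/-! ### Supports and lower bounds for Hilbert path metrics. -/

section Hilbert

variable {𝔽 : Type u} [Field 𝔽] {ι : Type}

theorem hilbertAmplitude_iso {m : MeasurableSpace (Rn ι)} (μ : Measure (Rn ι)) (p : ℝ)
    {M N : PMod 𝔽 ι} (e : M ≅ N) : hilbertAmplitude μ p M = hilbertAmplitude μ p N := by
  rw [hilbertAmplitude, hilbertAmplitude]
  congr 1
  exact lintegral_congr fun x => by rw [(e.app x).toLinearEquiv.finrank_eq]

theorem hilbertAmplitude_eq_zero_of_ae {m : MeasurableSpace (Rn ι)} (μ : Measure (Rn ι)) {p : ℝ}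
    (hp : 1 ≤ p) {M : PMod 𝔽 ι} (h : μ (moduleSupport M) = 0) : hilbertAmplitude μ p M = 0 := by
  have hp0 : 0 < p := by linarith
  have : ∫⁻ x, (Module.finrank 𝔽 (M.obj x) : ℝ≥0∞) ^ p ∂μ = 0 := by
    rw [← lintegral_zero (μ := μ)]
    refine lintegral_congr_ae ?_
    have h' : ∀ᵐ x ∂μ, x ∉ moduleSupport M := measure_eq_zero_iff_ae_notMem.1 h
    filter_upwards [h'] with x hx
    rw [finrank_eq_zero_of_isZero (not_not.1 hx), Nat.cast_zero, ENNReal.zero_rpow_of_pos hp0]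
  rw [hilbertAmplitude, this, ENNReal.zero_rpow_of_pos (by positivity)]

theorem hilbertAmplitude_eq_zero_of_isZero {m : MeasurableSpace (Rn ι)} (μ : Measure (Rn ι))
    {p : ℝ} (hp : 1 ≤ p) {M : PMod 𝔽 ι} (h : IsZero M) : hilbertAmplitude μ p M = 0 := by
  refine hilbertAmplitude_eq_zero_of_ae μ hp ?_
  have : moduleSupport M = ∅ := Set.eq_empty_of_forall_notMem fun x hx => hx (h.obj x)
  rw [this]
  exact measure_empty

variable [Fintype ι]

theorem measurableSet_lebesgueAlgebra {S : Set (ι → ℝ)} (hS : MeasurableSet S) :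
    MeasurableSet[lebesgueAlgebra ι] (S : Set (Rn ι)) :=
  hS.nullMeasurableSet (μ := volume)

/-- A nonzero finite dimension is at least one, so the integrand dominates the indicator of the
support. Finiteness matters, as `finrank` is zero on infinite-dimensional spaces. -/
theorem measure_moduleSupport_le (μ : @Measure (Rn ι) (lebesgueAlgebra ι)) {p : ℝ} (hp : 1 ≤ p)
    {M : PMod 𝔽 ι} (hM : IsTame M) : μ (moduleSupport M) ≤ hilbertAmplitude μ p M ^ p := by
  have hp0 : 0 < p := by linarith
  obtain ⟨⟨T, hT⟩, hfin⟩ := hM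
  rw [hilbertAmplitude, ← ENNReal.rpow_mul, one_div_mul_cancel hp0.ne', ENNReal.rpow_one,
    ← lintegral_indicator_one (measurableSet_lebesgueAlgebra hT.measurableSet_moduleSupport)]
  refine lintegral_mono fun x => ?_
  by_cases hx : x ∈ (moduleSupport M : Set (Rn ι))
  · rw [Set.indicator_of_mem hx]
    have := hfin x
    refine ENNReal.one_le_rpow ?_ hp0
    exact_mod_cast one_le_finrank_of_not_isZero hx
  · rw [Set.indicator_of_notMem hx]
    exact zero_le

omit [Fintype ι] in
theorem isZero_iff_of_notMem_moduleSupport {M N : PMod 𝔽 ι} (f : M ⟶ N) {x : Rn ι}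
    (hk : x ∉ (moduleSupport (kernel f) : Set (Rn ι)))
    (hc : x ∉ (moduleSupport (cokernel f) : Set (Rn ι))) :
    IsZero (M.obj x) ↔ IsZero (N.obj x) := by
  have := Preadditive.mono_of_isZero_kernel (f.app x)
    ((kernelObjIso f x).isZero_iff.1 (not_not.1 hk))
  have := Preadditive.epi_of_isZero_cokernel (f.app x)
    ((cokernelObjIso f x).isZero_iff.1 (not_not.1 hc))
  have := isIso_of_mono_of_epi (f.app x)
  exact (asIso (f.app x)).isZero_iff

/-- The points at which precisely one of two modules vanishes. -/
def supportDiff (M N : PMod 𝔽 ι) : Set (Rn ι) :=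
  {x | ¬ (IsZero (M.obj x) ↔ IsZero (N.obj x))}

/-- Off the supports of its kernel and cokernel a morphism is pointwise invertible. Subadditivity of
`μ` then combines with `a ^ p + b ^ p ≤ (a + b) ^ p`, which is where `1 ≤ p` enters. -/
theorem measure_supportDiff_le_cost (μ : @Measure (Rn ι) (lebesgueAlgebra ι)) {p : ℝ}
    (hp : 1 ≤ p) {A B : PMod 𝔽 ι} (z : Zigzag IsCubicallyEncoded A B)
    (hA : IsCubicallyEncoded A) :
    μ (supportDiff A B) ≤ z.cost (hilbertAmplitude μ p) ^ p := by
  induction z with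
  | nil A =>
    have : supportDiff A A = ∅ := Set.eq_empty_of_forall_notMem fun x hx => hx Iff.rfl
    rw [this]
    exact measure_empty.trans_le zero_le
  | @cons A C B D hC hB f g z ih =>
    have hsub : supportDiff A D ⊆ ((moduleSupport (kernel f) ∪ moduleSupport (cokernel f)) ∪
        (moduleSupport (kernel g) ∪ moduleSupport (cokernel g)) : Set (Rn ι)) ∪
          supportDiff B D := by
      intro x hx
      by_contra hx'
      have h1 := fun h => hx' (.inl (.inl (.inl h)))
      have h2 := fun h => hx' (.inl (.inl (.inr h)))
      have h3 := fun h => hx' (.inl (.inr (.inl h)))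
      have h4 := fun h => hx' (.inl (.inr (.inr h)))
      have h5 := not_not.1 fun h => hx' (.inr h)
      exact hx ((isZero_iff_of_notMem_moduleSupport f h1 h2).symm.trans
        ((isZero_iff_of_notMem_moduleSupport g h3 h4).trans h5))
    have key {M N : PMod 𝔽 ι} (f : M ⟶ N) (hM : IsCubicallyEncoded M)
        (hN : IsCubicallyEncoded N) :
        μ (moduleSupport (kernel f) ∪ moduleSupport (cokernel f) : Set (Rn ι)) ≤
          (hilbertAmplitude μ p (kernel f) + hilbertAmplitude μ p (cokernel f)) ^ p := by
      obtain ⟨h1, h2⟩ := IsCubicallyEncoded.isTame_kernel_cokernel f hM hN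
      exact (measure_union_le _ _).trans ((add_le_add (measure_moduleSupport_le μ hp h1)
        (measure_moduleSupport_le μ hp h2)).trans (ENNReal.add_rpow_le_rpow_add _ _ hp))
    refine (measure_mono hsub).trans ((measure_union_le _ _).trans ?_)
    refine le_trans (add_le_add ?_ (ih hB)) (ENNReal.add_rpow_le_rpow_add _ _ hp)
    refine (measure_union_le _ _).trans ?_
    exact (add_le_add (key f hC hA) (key g hC hB)).trans (ENNReal.add_rpow_le_rpow_add _ _ hp)

theorem measure_supportDiff_rpow_le_pathDist (μ : @Measure (Rn ι) (lebesgueAlgebra ι)) {p : ℝ}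
    (hp : 1 ≤ p) {A B : PMod 𝔽 ι} (hA : IsCubicallyEncoded A) :
    μ (supportDiff A B) ^ (1 / p) ≤ pathDist IsCubicallyEncoded (hilbertAmplitude μ p) A B := by
  refine le_iInf fun z => ?_
  rw [one_div, ENNReal.rpow_inv_le_iff (by linarith)]
  exact measure_supportDiff_le_cost μ hp z hA

end Hilbert

/-! ### Lebesgue measures -/

section Lebesgue

variable {𝔽 : Type u} [Field 𝔽] {ι : Type} [DecidableEq ι] {σ : Finset ι}

theorem IsGridConstant.isZero_quotRestrict_iff {T : Finset ℝ} {M : PMod 𝔽 ι}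
    (hM : IsGridConstant T M) {s : face σ} (hs : IsBeyond T s) (w : Rn (OffFace σ)) :
    IsZero (((quotRestrict 𝔽 σ).obj M).obj w) ↔ IsZero (M.obj (addFace σ w s)) := by
  have := hM.isIso_colimMap hs w
  exact (asIso (colimMap M w s)).isZero_iff.symm

theorem addFace_proj_faceOf {x : Rn ι} (hx : ∀ i ∈ σ, 0 ≤ x i) :
    addFace σ (proj σ x) (faceOf σ x) = x := by
  funext i
  by_cases hi : i ∈ σ
  · rw [addFace_of_mem _ _ hi]
    simp [faceOf, hi, hx i hi]
  · rw [addFace_of_notMem _ _ hi]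
    rfl

variable [Fintype ι]

/-- The set is a product of `E` with a nonempty power of a half-line of infinite length; the product
formula does not ask `E` to be measurable. -/
theorem volume_cylinder_eq_top (hσ : σ.Nonempty) (r : ℝ) {E : Set (OffFace σ → ℝ)}
    (hE : volume E ≠ 0) :
    volume {x : ι → ℝ | (fun i : OffFace σ => x i) ∈ E ∧ ∀ i ∈ σ, r ≤ x i} = ⊤ := by
  have hpres := volume_preserving_piEquivPiSubtypeProd (fun _ : ι => ℝ) (fun i => i ∉ σ)
  have hS : {x : ι → ℝ | (fun i : OffFace σ => x i) ∈ E ∧ ∀ i ∈ σ, r ≤ x i} =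
      MeasurableEquiv.piEquivPiSubtypeProd (fun _ : ι => ℝ) (fun i => i ∉ σ) ⁻¹'
        (E ×ˢ Set.univ.pi fun _ => Set.Ici r) := by
    ext x
    refine and_congr_right fun _ => ⟨fun h i _ => h i (not_not.1 i.2), fun h i hi => ?_⟩
    exact h ⟨i, not_not.2 hi⟩ trivial
  obtain ⟨i, hi⟩ := hσ
  have : Nonempty {i // ¬ i ∉ σ} := ⟨⟨i, not_not.2 hi⟩⟩
  rw [hS, hpres.measure_preimage_equiv, Measure.volume_eq_prod, Measure.prod_prod, volume_pi_pi]
  simp only [Real.volume_Ici, Finset.prod_const]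
  rw [ENNReal.top_pow (Finset.card_ne_zero.2 Finset.univ_nonempty), ENNReal.mul_top hE]

/-- If the support of M/τ were not null, the support of M would contain an infinite-volume cylinder
over it, contradicting `measure_moduleSupport_le`. -/
theorem hilbertAmplitude_quotRestrict_eq_zero (hσ : σ.Nonempty) {M : PMod 𝔽 ι} (hM : IsTame M)
    {p : ℝ} (hp : 1 ≤ p) (hfin : hilbertAmplitude (lebesgueMeasure ι) p M ≠ ⊤) :
    hilbertAmplitude (lebesgueMeasure (OffFace σ)) p ((quotRestrict 𝔽 σ).obj M) = 0 := by
  have hp0 : 0 < p := by linarith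
  refine hilbertAmplitude_eq_zero_of_ae _ hp ?_
  refine (Measure.completion_apply (volume : Measure (OffFace σ → ℝ)) _).trans ?_
  by_contra hE
  obtain ⟨T, hT⟩ := hM.1
  obtain ⟨r, hr⟩ := exists_isBeyond_facePt σ T
  have hsub : {x : ι → ℝ | (fun i : OffFace σ => x i) ∈
      moduleSupport ((quotRestrict 𝔽 σ).obj M) ∧ ∀ i ∈ σ, (r : ℝ) ≤ x i} ⊆ moduleSupport M := by
    rintro x ⟨hx, hxr⟩ h0
    have hs : IsBeyond T (faceOf σ x) := fun i hi c hc => by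
      have := hr i hi c hc
      simp only [facePt, hi, if_true] at this
      simp only [faceOf, hi, if_true]
      exact this.trans_le ((hxr i hi).trans (le_max_left _ _))
    refine hx ((hT.isZero_quotRestrict_iff hs _).2 ?_)
    have := addFace_proj_faceOf (σ := σ) (x := x) fun i hi => r.2.trans (hxr i hi)
    exact this.symm ▸ h0
  have htop : volume (moduleSupport M) = ⊤ :=
    measure_mono_top hsub (volume_cylinder_eq_top hσ r hE)
  have := measure_moduleSupport_le (lebesgueMeasure ι) hp hM
  have h2 : lebesgueMeasure ι (moduleSupport M) = ⊤ :=
    (Measure.completion_apply (volume : Measure (ι → ℝ)) _).trans htop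
  rw [h2, top_le_iff, ENNReal.rpow_eq_top_iff_of_pos hp0] at this
  exact hfin this

end Lebesgue

end PersMod

/-! ### Indicator modules of far away orthants -/

namespace PersMod

section Indicator

variable {𝔽 : Type u} [Field 𝔽] {ι : Type}

variable (𝔽) in
/-- The functor on the poset of truth values that is `0` on `false` and `𝔽` on `true`. -/
def stepFunctor : Bool ⥤ ModuleCat.{u} 𝔽 where
  obj b := ModuleCat.of 𝔽 (if b then ⊤ else ⊥ : Submodule 𝔽 𝔽)
  map {b c} h := ModuleCat.ofHom (Submodule.inclusion (by
    have := leOfHom h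
    cases b
    · exact bot_le
    · rw [this (by rfl)]))

theorem finrank_stepFunctor (b : Bool) :
    Module.finrank 𝔽 ((stepFunctor 𝔽).obj b) = if b then 1 else 0 := by
  cases b
  · exact finrank_bot 𝔽 𝔽
  · exact (finrank_top 𝔽 𝔽).trans (Module.finrank_self 𝔽)

instance (b : Bool) : Module.Finite 𝔽 ((stepFunctor 𝔽).obj b) :=
  inferInstanceAs (Module.Finite 𝔽 (if b then ⊤ else ⊥ : Submodule 𝔽 𝔽))

open Classical in
/-- The indicator of the set of points whose coordinates in `σ` are at least `r`. -/
noncomputable def orthantMap (σ : Finset ι) (r : ℝ) : Rn ι →o Bool where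
  toFun x := decide (∀ i ∈ σ, r ≤ x i)
  monotone' x y h := by
    rw [Bool.le_iff_imp]
    simp only [decide_eq_true_eq]
    exact fun hx i hi => (hx i hi).trans (h i)

theorem orthantMap_eq_true {σ : Finset ι} {r : ℝ} {x : Rn ι} :
    orthantMap σ r x = true ↔ ∀ i ∈ σ, r ≤ x i := by
  classical
  exact decide_eq_true_iff

variable (𝔽) in
/-- The module that is `𝔽` on the set of points whose coordinates in `σ` are at least `r`, and
zero elsewhere. -/
noncomputable def orthantModule (σ : Finset ι) (r : ℝ) : PMod 𝔽 ι :=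
  (orthantMap σ r).monotone.functor ⋙ stepFunctor 𝔽

theorem finrank_orthantModule (σ : Finset ι) (r : ℝ) (x : Rn ι) :
    Module.finrank 𝔽 ((orthantModule 𝔽 σ r).obj x) = if orthantMap σ r x then 1 else 0 :=
  finrank_stepFunctor _

theorem isCubicallyEncoded_orthantModule (σ : Finset ι) (r : ℝ) :
    IsCubicallyEncoded (orthantModule 𝔽 σ r) := by
  classical
  refine ⟨Bool, inferInstance, inferInstance, orthantMap σ r, stepFunctor 𝔽,
    fun _ => inferInstance, fun b => ?_, ⟨Iso.refl _⟩⟩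
  cases b
  -- The complement of the orthant is the finite union of the half-spaces `x i < r` for `i ∈ σ`.
  · refine ⟨(fun i => {x : Rn ι | x i < r}) '' σ, σ.finite_toSet.image _, ?_, ?_⟩
    · rintro _ ⟨i, -, rfl⟩
      refine ⟨fun j => if j = i then Set.Iio r else Set.univ, fun j => ?_, ?_⟩
      · dsimp only
        split_ifs
        · exact Set.ordConnected_Iio
        · exact Set.ordConnected_univ
      · refine Set.Subset.antisymm (fun x (hx : x i < r) j _ => ?_) fun x hx => ?_
        · dsimp only
          split_ifs with h
          · exact h ▸ hx
          · trivial
        · simpa using hx i trivial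
    · refine Set.ext fun x => ?_
      have : orthantMap σ r x = false ↔ ∃ i ∈ σ, x i < r := by
        rw [← Bool.not_eq_true, orthantMap_eq_true]
        push Not
        rfl
      refine this.trans ⟨fun ⟨i, hi, h⟩ => ⟨_, ⟨i, hi, rfl⟩, h⟩, ?_⟩
      rintro ⟨_, ⟨i, hi, rfl⟩, h⟩
      exact ⟨i, hi, h⟩
  · refine ⟨{{x : Rn ι | ∀ i ∈ σ, r ≤ x i}}, Set.finite_singleton _, ?_, ?_⟩
    · rintro _ rfl
      refine ⟨fun j => if j ∈ σ then Set.Ici r else Set.univ, fun j => ?_, ?_⟩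
      · dsimp only
        split_ifs
        · exact Set.ordConnected_Ici
        · exact Set.ordConnected_univ
      · refine Set.Subset.antisymm (fun x hx j _ => ?_) fun x hx j hj => ?_
        · dsimp only
          split_ifs with h
          · exact hx j h
          · trivial
        · simpa [hj] using hx j trivial
    · rw [Set.sUnion_singleton]
      exact Set.ext fun x => orthantMap_eq_true

theorem isCubicallyEncoded_of_isZero {M : PMod 𝔽 ι} (hM : IsZero M) : IsCubicallyEncoded M := by
  have h0 (x : Rn ι) : IsZero ((stepFunctor 𝔽).obj false) := by
    have : Subsingleton ((stepFunctor 𝔽).obj false) :=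
      inferInstanceAs (Subsingleton (⊥ : Submodule 𝔽 𝔽))
    exact ModuleCat.isZero_of_subsingleton _
  let e : Rn ι →o Bool := OrderHom.const _ false
  have hz : IsZero (e.monotone.functor ⋙ stepFunctor 𝔽) := Functor.isZero _ h0
  refine ⟨Bool, inferInstance, inferInstance, e, stepFunctor 𝔽, fun _ => inferInstance,
    fun b => ?_, ⟨hM.iso hz⟩⟩
  cases b
  · refine ⟨{Set.univ}, Set.finite_singleton _, ?_, ?_⟩
    · rintro _ rfl
      exact ⟨fun _ => Set.univ, fun _ => Set.ordConnected_univ, (Set.pi_univ _).symm⟩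
    · rw [Set.sUnion_singleton]
      exact Set.eq_univ_of_forall fun x => rfl
  · refine ⟨∅, Set.finite_empty, by simp, ?_⟩
    rw [Set.sUnion_empty]
    exact Set.eq_empty_of_forall_notMem fun x hx => Bool.false_ne_true hx

theorem not_isZero_quotRestrict_orthantModule [Finite ι] [DecidableEq ι] (σ : Finset ι) (r : ℝ)
    (w : Rn (OffFace σ)) :
    ¬ IsZero (((quotRestrict 𝔽 σ).obj (orthantModule 𝔽 σ r)).obj w) := by
  obtain ⟨T, hT⟩ := (isCubicallyEncoded_orthantModule (𝔽 := 𝔽) σ r).exists_isGridConstant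
  -- Adding `r` to the cutpoints places the slice inside the orthant as well as beyond the grid.
  obtain ⟨a, ha⟩ := exists_isBeyond_facePt σ (insert r T)
  have hT' : IsBeyond T (facePt σ a) := fun i hi c hc => ha i hi c (Finset.mem_insert_of_mem hc)
  rw [hT.isZero_quotRestrict_iff hT']
  intro h
  have h1 := finrank_eq_zero_of_isZero h
  have h2 : orthantMap σ r (addFace σ w (facePt σ a)) = true :=
    orthantMap_eq_true.2 fun i hi => by
      rw [addFace_of_mem _ _ hi]
      exact (ha i hi r (Finset.mem_insert_self r T)).le
  rw [finrank_orthantModule, h2] at h1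
  exact one_ne_zero h1

variable [Fintype ι]

theorem measurableSet_orthant (σ : Finset ι) (r : ℝ) :
    MeasurableSet[lebesgueAlgebra ι] {x : Rn ι | ∀ i ∈ σ, r ≤ x i} := by
  refine measurableSet_lebesgueAlgebra (S := {x : ι → ℝ | ∀ i ∈ σ, r ≤ x i}) ?_
  exact measurableSet_of_sameCell (T := {r}) fun x y h hx i hi =>
    (h i r (Finset.mem_singleton_self r)).2.1 (hx i hi)

theorem hilbertAmplitude_orthantModule (μ : @Measure (Rn ι) (lebesgueAlgebra ι)) {p : ℝ}
    (hp : 1 ≤ p) (σ : Finset ι) (r : ℝ) :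
    hilbertAmplitude μ p (orthantModule 𝔽 σ r) = μ {x | ∀ i ∈ σ, r ≤ x i} ^ (1 / p) := by
  have hp0 : 0 < p := by linarith
  rw [hilbertAmplitude, ← lintegral_indicator_one (measurableSet_orthant σ r)]
  congr 1
  refine lintegral_congr fun x => ?_
  rw [finrank_orthantModule]
  by_cases hx : orthantMap σ r x = true
  · rw [Set.indicator_of_mem (show x ∈ {x : Rn ι | ∀ i ∈ σ, r ≤ x i} from
      orthantMap_eq_true.1 hx), hx]
    simp
  · rw [Set.indicator_of_notMem (show x ∉ {x : Rn ι | ∀ i ∈ σ, r ≤ x i} from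
      fun h => hx (orthantMap_eq_true.2 h))]
    simp [hx, hp0]

/-- Continuity from above: since `σ` is nonempty, the orthants decrease to the empty set, and `μ` is
finite. -/
theorem exists_measure_orthant_lt (μ : @Measure (Rn ι) (lebesgueAlgebra ι))
    (hμ : μ Set.univ < ⊤) {σ : Finset ι} (hσ : σ.Nonempty) {δ : ℝ≥0∞} (hδ : 0 < δ) :
    ∃ r : ℝ, μ {x | ∀ i ∈ σ, r ≤ x i} < δ := by
  have h := tendsto_measure_iInter_atTop (μ := μ)
    (s := fun k : ℕ => {x : Rn ι | ∀ i ∈ σ, (k : ℝ) ≤ x i})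
    (fun k => (measurableSet_orthant σ k).nullMeasurableSet)
    (fun j k hjk x hx i hi => le_trans (Nat.cast_le.2 hjk) (hx i hi))
    ⟨0, ((measure_mono (Set.subset_univ _)).trans_lt hμ).ne⟩
  have h0 : (⋂ k : ℕ, {x : Rn ι | ∀ i ∈ σ, (k : ℝ) ≤ x i}) = ∅ := by
    obtain ⟨i, hi⟩ := hσ
    refine Set.eq_empty_of_forall_notMem fun x hx => ?_
    obtain ⟨k, hk⟩ := exists_nat_gt (x i)
    exact hk.not_ge (Set.mem_iInter.1 hx k i hi)
  rw [h0, measure_empty] at h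
  obtain ⟨k, hk⟩ := (h.eventually_lt_const hδ).exists
  exact ⟨k, hk⟩

theorem pathDist_zero_le (μ : @Measure (Rn ι) (lebesgueAlgebra ι)) {p : ℝ} (hp : 1 ≤ p)
    {M N : PMod 𝔽 ι} (hM : IsZero M) (hN : IsCubicallyEncoded N) :
    pathDist IsCubicallyEncoded (hilbertAmplitude μ p) M N ≤ hilbertAmplitude μ p N := by
  have : Mono (0 : M ⟶ N) := ⟨fun _ _ _ => hM.eq_of_tgt _ _⟩
  -- In the zigzag `M ← M → N` only the cokernel of the zero map, namely N, has nonzero cost.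
  refine (iInf_le _ (.cons (isCubicallyEncoded_of_isZero hM) hN (𝟙 M) (0 : M ⟶ N) (.nil N))).trans
    ?_
  simp only [Zigzag.cost]
  rw [hilbertAmplitude_eq_zero_of_isZero μ hp (isZero_kernel_of_mono (𝟙 M)),
    hilbertAmplitude_eq_zero_of_isZero μ hp (isZero_cokernel_of_epi (𝟙 M)),
    hilbertAmplitude_eq_zero_of_isZero μ hp (isZero_kernel_of_mono (0 : M ⟶ N)),
    hilbertAmplitude_iso μ p (cokernelZeroIsoTarget (X := M) (Y := N))]
  simp

variable [DecidableEq ι]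

theorem not_continuousWith_quotRestrict {σ : Finset ι} (hσ : σ.Nonempty)
    [Nonempty (OffFace σ)]
    (μ : @Measure (Rn ι) (lebesgueAlgebra ι))
    (μ' : @Measure (Rn (OffFace σ)) (lebesgueAlgebra (OffFace σ)))
    (hμ : μ Set.univ < ⊤) (hμ' : μ' ≠ 0) {p : ℝ} (hp : 1 ≤ p) :
    ¬ ContinuousWith (IsCubicallyEncoded (𝔽 := 𝔽))
      (pathDist IsCubicallyEncoded (hilbertAmplitude μ p))
      (pathDist IsCubicallyEncoded (hilbertAmplitude μ' p)) (quotRestrict 𝔽 σ).obj := by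
  have hp0 : 0 < p := by linarith
  intro hcont
  obtain ⟨Z, hz⟩ := HasZeroObject.zero (C := PMod 𝔽 ι)
  have hpos : 0 < μ' Set.univ ^ (1 / p) :=
    ENNReal.rpow_pos_of_nonneg (Measure.measure_univ_pos.2 hμ') (by positivity)
  -- Continuity fails at the zero module. The tolerance is `μ' Set.univ ^ (1 / p)`, a lower bound
  -- for the target distance that does not depend on `r`.
  obtain ⟨δ, hδ, h⟩ := hcont Z (isCubicallyEncoded_of_isZero hz) _ hpos
  obtain ⟨r, hr⟩ := exists_measure_orthant_lt μ hμ hσ (δ := δ ^ p)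
    (ENNReal.rpow_pos_of_nonneg hδ hp0.le)
  have hN := isCubicallyEncoded_orthantModule (𝔽 := 𝔽) σ r
  have h1 := h _ hN ((pathDist_zero_le μ hp hz hN).trans_lt (by
    rw [hilbertAmplitude_orthantModule μ hp, one_div]
    exact (ENNReal.rpow_inv_lt_iff hp0).2 hr))
  have hQ : IsZero ((quotRestrict 𝔽 σ).obj Z) := (quotRestrict 𝔽 σ).map_isZero hz
  have h2 := measure_supportDiff_rpow_le_pathDist μ' hp
    (B := (quotRestrict 𝔽 σ).obj (orthantModule 𝔽 σ r)) (isCubicallyEncoded_of_isZero hQ)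
  have h3 : supportDiff ((quotRestrict 𝔽 σ).obj Z)
      ((quotRestrict 𝔽 σ).obj (orthantModule 𝔽 σ r)) = Set.univ :=
    Set.eq_univ_of_forall fun w hw =>
      not_isZero_quotRestrict_orthantModule σ r w (hw.1 (hQ.obj w))
  rw [h3] at h2
  exact (h2.trans_lt h1).false

end Indicator

end PersMod

theorem mainTheorem8 (𝔽 : Type u) [Field 𝔽] (n t : ℕ) (σ : Finset (Fin n)) (hσ : σ.card = t)
    (ht : 1 ≤ t) (htn : t ≤ n - 1) :
    -- the functor restricts to cubically encoded modules
    (∀ M : PMod 𝔽 (Fin n), IsCubicallyEncoded M →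
      IsCubicallyEncoded ((quotRestrict 𝔽 σ).obj M)) ∧
    -- 1. shift amplitudes and interleaving distances
    (∀ v : Fin n → ℝ≥0, ∀ M N : PMod 𝔽 (Fin n), IsCubicallyEncoded M → IsCubicallyEncoded N →
      pathDist IsCubicallyEncoded (shiftAmplitude fun i : OffFace σ => v i)
          ((quotRestrict 𝔽 σ).obj M) ((quotRestrict 𝔽 σ).obj N) ≤
        pathDist IsCubicallyEncoded (shiftAmplitude v) M N ∧
      interleavingDist (fun i : OffFace σ => v i)
          ((quotRestrict 𝔽 σ).obj M) ((quotRestrict 𝔽 σ).obj N) ≤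
        interleavingDist v M N) ∧
    -- 2. Lipschitz continuity for Hilbert amplitudes of the Lebesgue measures
    (∀ M N : PMod 𝔽 (Fin n), IsCubicallyEncoded M → IsCubicallyEncoded N →
      ∀ K : ℝ≥0, 0 < K → ∀ p : ℝ, 1 ≤ p →
        pathDist IsCubicallyEncoded (hilbertAmplitude (lebesgueMeasure (OffFace σ)) p)
            ((quotRestrict 𝔽 σ).obj M) ((quotRestrict 𝔽 σ).obj N) ≤
          K * pathDist IsCubicallyEncoded (hilbertAmplitude (lebesgueMeasure (Fin n)) p) M N) ∧
    -- 3. discontinuity for a finite measure on the source and a nonzero one on the target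
    (∀ (μ : @MeasureTheory.Measure (Rn (Fin n)) (lebesgueAlgebra (Fin n)))
      (μ' : @MeasureTheory.Measure (Rn (OffFace σ)) (lebesgueAlgebra (OffFace σ))),
      μ Set.univ < ⊤ → μ' ≠ 0 → ∀ p : ℝ, 1 ≤ p →
        ¬ ContinuousWith (IsCubicallyEncoded (𝔽 := 𝔽))
          (pathDist IsCubicallyEncoded (hilbertAmplitude μ p))
          (pathDist IsCubicallyEncoded (hilbertAmplitude μ' p))
          (quotRestrict 𝔽 σ).obj) := by
  have hne : σ.Nonempty := Finset.card_pos.1 (by omega)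
  have : Nonempty (OffFace σ) := by
    by_contra! h
    have huniv : σ = Finset.univ :=
      Finset.eq_univ_iff_forall.2 fun i => by_contra fun hi => h.false ⟨i, hi⟩
    have := congrArg Finset.card huniv
    rw [Finset.card_univ, Fintype.card_fin] at this
    omega
  refine ⟨fun M hM => hM.quotRestrict, fun v M N hM hN =>
    ⟨?_, interleavingDist_quotRestrict_le v M N⟩, fun M N hM hN K hK p hp => ?_,
    fun μ μ' hμ hμ' p hp => not_continuousWith_quotRestrict hne μ μ' hμ hμ' hp⟩
  -- The shift amplitude comparison holds for all modules, so `Q` imposes no condition.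
  · have := pathDist_map_le (quotRestrict 𝔽 σ) (P := IsCubicallyEncoded) (Q := fun _ => True)
      (P' := IsCubicallyEncoded) (fun M hM => hM.quotRestrict) (fun _ _ _ => ⟨trivial, trivial⟩)
      (α := shiftAmplitude v) (β := shiftAmplitude fun i : OffFace σ => v i)
      (fun e => shiftAmplitude_iso _ e) one_ne_zero ENNReal.one_ne_top
      (fun M _ => (one_mul (shiftAmplitude v M)).symm ▸ shiftAmplitude_quotRestrict_le v M)
      (B := N) hM
    rwa [one_mul] at this
  · have hK0 : (K : ℝ≥0∞) ≠ 0 := ENNReal.coe_ne_zero.2 hK.ne'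
    refine pathDist_map_le (quotRestrict 𝔽 σ) (Q := IsTame) (fun M hM => hM.quotRestrict)
      (fun f hX hY => IsCubicallyEncoded.isTame_kernel_cokernel f hX hY)
      (fun e => hilbertAmplitude_iso _ p e) hK0 ENNReal.coe_ne_top (fun M hM => ?_) hM
    -- An infinite amplitude makes the right side infinite, as `K ≠ 0`; a finite one forces the left
    -- side to vanish.
    by_cases h : hilbertAmplitude (lebesgueMeasure (Fin n)) p M = ⊤
    · rw [h, ENNReal.mul_top hK0]
      exact le_top
    · exact (hilbertAmplitude_quotRestrict_eq_zero hne hM hp h).trans_le zero_le
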